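/- Let $\mathcal X$ be a real inner product space of dimension greater than $1$ (possibly infinite), let $\mathbf B=\{x\in\mathcal X:\|x\|<R\}$ with $R>0$ be an open ball centred at the origin, and let $\mathcal Y$ be a real sequentially complete topological vector space. Let $r,s,t$ be positive integers with $s=t>\frac{1}{\sqrt2}\,r$, and let $f:\mathbf B\setminus\{0\}\to\mathcal Y$ be orthogonally generalized Jensen, that is, $$ r\,f\!\left(\frac{sx+ty}{r}\right)=s\,f(x)+t\,f(y) $$ for all $x,y\in\mathbf B\setminus\{0\}$ with $\langle x,y\rangle=0$ and $\frac{sx+ty}{r}\in\mathbf B\setminus\{0\}$. Then there exist additive mappings $T:\mathcal X\to\mathcal Y$ and $b:[0,\infty)\to\mathcal Y$ such that $$ f(x)=T(x)+b\!\left(\|x\|^2\right)\qquad\text{for all }x\in\mathbf B\setminus\{0\}. $$ -/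

import Mathlib

/-- `f` satisfies the generalized Jensen equation `r f((s x + t y) / r) = s f(x) + t f(y)` for all
orthogonal `x, y` in the domain `D` for which `(s x + t y) / r` lies in `D` as well
(the values of `f` outside `D` play no role). -/
def IsOrthogonallyGeneralizedJensenOn {X Y : Type*} [NormedAddCommGroup X] [InnerProductSpace ℝ X]
    [AddCommGroup Y] [Module ℝ Y] (r s t : ℕ) (D : Set X) (f : X → Y) : Prop :=
  ∀ x ∈ D, ∀ y ∈ D, inner ℝ x y = 0 →
    (r : ℝ)⁻¹ • ((s : ℝ) • x + (t : ℝ) • y) ∈ D →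
      (r : ℝ) • f ((r : ℝ)⁻¹ • ((s : ℝ) • x + (t : ℝ) • y)) = (s : ℝ) • f x + (t : ℝ) • f y

/-- Every Cauchy sequence converges. -/
def IsSequentiallyComplete (Y : Type*) [UniformSpace Y] : Prop :=
  ∀ u : ℕ → Y, CauchySeq u → ∃ a : Y, Filter.Tendsto u Filter.atTop (nhds a)

/-! Put l = s / r. Near zero f splits into an odd and an even part, each solving the same equation.
Odd part: if ‖y‖² = ab and y ⟂ e for a unit vector e, then ae + y ⟂ be - y, and using the equation
three times gives g(l²(a+b)e) = l²(g(ae) + g(be)). Since l² is rational and 2l² ≠ 1, this forces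
additivity on rays, then on orthogonal pairs, then near zero. Even part: it depends only on the
norm, so as a function h of ‖x‖² it satisfies h(l²(a+b)) = l(h a + h b). It is additive if l = 1 and
zero otherwise. Both pieces extend by halving. Subtracting them from f leaves a solution that
vanishes near zero. As 2l² > 1, each z is l times a sum of two shorter orthogonal vectors, so the
vanishing spreads to the whole ball. -/

/-- Equation `f (l (x + y)) = l (f x + f y)` for orthogonal nonzero `x, y` such that `x`, `y` and
`l (x + y)` have norm less than `R`. -/
def OrthJensenBelow {X Y : Type*} [NormedAddCommGroup X] [InnerProductSpace ℝ X]
    [AddCommGroup Y] [Module ℝ Y] (l R : ℝ) (f : X → Y) : Prop :=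
  ∀ x y : X, x ≠ 0 → y ≠ 0 → ‖x‖ < R → ‖y‖ < R → inner ℝ x y = 0 → ‖l • (x + y)‖ < R →
    f (l • (x + y)) = l • (f x + f y)

/-! ### Orthogonal vectors and extension by halving -/

theorem exists_orthogonal_norm_eq {X : Type*} [NormedAddCommGroup X] [InnerProductSpace ℝ X]
    (hX : 1 < Module.rank ℝ X) (x : X) {ρ : ℝ} (hρ : 0 ≤ ρ) :
    ∃ y : X, inner ℝ x y = 0 ∧ ‖y‖ = ρ := by
  have hne : (Submodule.span ℝ {x})ᗮ ≠ ⊥ := by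
    intro h
    rw [Submodule.orthogonal_eq_bot_iff] at h
    have h1 : Module.rank ℝ (Submodule.span ℝ {x}) ≤ 1 := by
      simpa using rank_span_le (R := ℝ) ({x} : Set X)
    rw [h, rank_top] at h1
    exact absurd h1 (not_le.mpr hX)
  obtain ⟨y, hy, hy0⟩ := Submodule.exists_mem_ne_zero_of_ne_bot hne
  have hxy : inner ℝ x y = 0 := Submodule.mem_orthogonal_singleton_iff_inner_right.mp hy
  refine ⟨(ρ / ‖y‖) • y, by rw [inner_smul_right, hxy, mul_zero], ?_⟩
  rw [norm_smul, Real.norm_of_nonneg (by positivity)]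
  exact div_mul_cancel₀ _ (norm_ne_zero_iff.mpr hy0)

theorem norm_sq_add_of_inner_eq_zero {X : Type*} [NormedAddCommGroup X] [InnerProductSpace ℝ X]
    {x y : X} (h : inner ℝ x y = 0) : ‖x + y‖ ^ 2 = ‖x‖ ^ 2 + ‖y‖ ^ 2 := by
  rw [norm_add_sq_real, h]; ring

theorem norm_le_norm_add_of_inner_eq_zero {X : Type*} [NormedAddCommGroup X]
    [InnerProductSpace ℝ X] {x y : X} (h : inner ℝ x y = 0) : ‖x‖ ≤ ‖x + y‖ := by
  have := norm_sq_add_of_inner_eq_zero h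
  exact (sq_le_sq₀ (norm_nonneg _) (norm_nonneg _)).mp (by nlinarith [sq_nonneg ‖y‖])

theorem add_ne_zero_of_inner_eq_zero {X : Type*} [NormedAddCommGroup X] [InnerProductSpace ℝ X]
    {x y : X} (h : inner ℝ x y = 0) (hx : x ≠ 0) : x + y ≠ 0 := by
  rw [← norm_pos_iff] at hx ⊢
  exact hx.trans_le (norm_le_norm_add_of_inner_eq_zero h)

/-- A map which is additive on a set that absorbs every point under halving agrees on that set with
an additive map. -/
theorem exists_addMonoidHom_eqOn {E Y : Type*} [AddCommMonoid E] [Module NNReal E]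
    [AddCommGroup Y] [Module ℝ Y] (U : Set E) (g : E → Y)
    (hhalf : ∀ x ∈ U, (2⁻¹ : NNReal) • x ∈ U)
    (habs : ∀ x, ∃ n : ℕ, ((2⁻¹ : NNReal) ^ n) • x ∈ U)
    (hadd : ∀ u ∈ U, ∀ v ∈ U, u + v ∈ U → g (u + v) = g u + g v) :
    ∃ T : E →+ Y, ∀ x ∈ U, g x = T x := by
  have hstep : ∀ x ∈ U, g x = (2 : ℝ) • g ((2⁻¹ : NNReal) • x) := by
    intro x hx
    have e : (2⁻¹ : NNReal) • x + (2⁻¹ : NNReal) • x = x := by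
      rw [← add_smul, ← two_mul, mul_inv_cancel₀ two_ne_zero, one_smul]
    have := hadd _ (hhalf x hx) _ (hhalf x hx) (by rwa [e])
    rw [e] at this
    rw [this, two_smul]
  have hmem : ∀ x (n k : ℕ), ((2⁻¹ : NNReal) ^ n) • x ∈ U → ((2⁻¹ : NNReal) ^ (n + k)) • x ∈ U := by
    intro x n k h
    induction k with
    | zero => exact h
    | succ k ih =>
      rw [← add_assoc, pow_succ', mul_smul]
      exact hhalf _ ih
  -- The value 2ⁿ g(2⁻ⁿ x) is independent of n once 2⁻ⁿ x lies in U, so it defines the extension.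
  -- Scalars in `NNReal` cover both X and the half-line.
  have hval : ∀ x (n k : ℕ), ((2⁻¹ : NNReal) ^ n) • x ∈ U →
      (2 : ℝ) ^ (n + k) • g (((2⁻¹ : NNReal) ^ (n + k)) • x)
        = (2 : ℝ) ^ n • g (((2⁻¹ : NNReal) ^ n) • x) := by
    intro x n k h
    induction k with
    | zero => rfl
    | succ k ih =>
      rw [← ih, hstep _ (hmem x n k h), ← add_assoc, pow_succ', pow_succ' (2⁻¹ : NNReal),
        mul_smul _ _ x, smul_smul _ (2 : ℝ),
        mul_comm (2 : ℝ)]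
  choose N hN using habs
  have hT : ∀ x (m : ℕ), N x ≤ m → (2 : ℝ) ^ (N x) • g (((2⁻¹ : NNReal) ^ (N x)) • x)
      = (2 : ℝ) ^ m • g (((2⁻¹ : NNReal) ^ m) • x) := by
    intro x m hm
    obtain ⟨k, rfl⟩ := Nat.exists_eq_add_of_le hm
    exact (hval x _ k (hN x)).symm
  have hU : ∀ x (m : ℕ), N x ≤ m → ((2⁻¹ : NNReal) ^ m) • x ∈ U := by
    intro x m hm
    obtain ⟨k, rfl⟩ := Nat.exists_eq_add_of_le hm
    exact hmem x _ k (hN x)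
  refine ⟨AddMonoidHom.mk' (fun x => (2 : ℝ) ^ (N x) • g (((2⁻¹ : NNReal) ^ (N x)) • x)) ?_, ?_⟩
  · intro x y
    let m := N x + N y + N (x + y)
    have h1 := hU x m (by omega)
    have h2 := hU y m (by omega)
    have h3 := hU (x + y) m (by omega)
    rw [hT x m (by omega), hT y m (by omega), hT (x + y) m (by omega)]
    rw [smul_add] at h3 ⊢
    rw [hadd _ h1 _ h2 h3, smul_add]
  · intro x hx
    have := hval x 0 (N x) (by simpa using hx)
    simpa using this.symm

/-! ### Jensen-type equations on small positive reals -/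

section PositiveReals

variable {Y : Type*} [AddCommGroup Y] [Module ℝ Y] {h : ℝ → Y} {m k ρ : ℝ}

/-- The left side of the equation depends only on a + b, so h((n+2)a) + h(a) = h((n+1)a) + h(2a):
the values at multiples of a form an arithmetic progression. -/
theorem apply_mul_eq_add_smul (hk : k ≠ 0)
    (H : ∀ a b, 0 < a → 0 < b → a < ρ → b < ρ → h (m * (a + b)) = k • (h a + h b))
    {a : ℝ} (ha : 0 < a) (ha2 : 2 * a < ρ) (n : ℕ) (hn : ((n : ℝ) + 1) * a < ρ) :
    h (((n : ℝ) + 1) * a) = h a + (n : ℝ) • (h (2 * a) - h a) := by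
  induction n with
  | zero => simp
  | succ n ih =>
    push_cast at hn ⊢
    have hna : 0 ≤ (n : ℝ) * a := by positivity
    have hb : ((n : ℝ) + 1) * a < ρ := by linarith
    have h1 := H (((n : ℝ) + 1 + 1) * a) a (by positivity) ha hn (by linarith)
    have h2 := H (((n : ℝ) + 1) * a) (2 * a) (by positivity) (by positivity) hb ha2
    rw [show ((n : ℝ) + 1 + 1) * a + a = ((n : ℝ) + 1) * a + 2 * a by ring, h2] at h1
    have h3 := smul_right_injective Y hk h1
    simp only [ih hb] at h3
    linear_combination (norm := module) -h3

theorem apply_natCast_mul_eq_add_smul (hk : k ≠ 0)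
    (H : ∀ a b, 0 < a → 0 < b → a < ρ → b < ρ → h (m * (a + b)) = k • (h a + h b))
    {a : ℝ} (ha : 0 < a) (ha2 : 2 * a < ρ) {n : ℕ} (h0 : 0 < n) (hn : (n : ℝ) * a < ρ) :
    h ((n : ℝ) * a) = h a + ((n : ℝ) - 1) • (h (2 * a) - h a) := by
  obtain ⟨n, rfl⟩ := Nat.exists_eq_succ_of_ne_zero h0.ne'
  push_cast at hn ⊢
  rw [apply_mul_eq_add_smul hk H ha ha2 n hn, add_sub_cancel_right]

/-- At the pair (r²a, r²a) both sides involve integer multiples of a, since 2l²r² = 2s². Comparing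
progressions leaves (2l² - 1)(h(2a) - 2h(a)) = 0. -/
theorem apply_two_mul_of_sq_ratio {r s : ℕ} (hr : 0 < r) (hs : 0 < s) {l : ℝ} (hl : l * r = s)
    (hl2 : 2 * l ^ 2 ≠ 1)
    (H : ∀ a b, 0 < a → 0 < b → a < ρ → b < ρ → h (l ^ 2 * (a + b)) = l ^ 2 • (h a + h b))
    {a : ℝ} (ha : 0 < a) (hN : ((3 * s ^ 2 + 3 * r ^ 2 : ℕ) : ℝ) * a < ρ) :
    h (2 * a) = (2 : ℝ) • h a := by
  have hr1 : (1 : ℝ) ≤ r := by exact_mod_cast hr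
  have hs1 : (1 : ℝ) ≤ s := by exact_mod_cast hs
  have hl0 : l ≠ 0 := by rintro rfl; rw [zero_mul] at hl; linarith
  push_cast at hN
  have hra : 1 * a ≤ (r : ℝ) ^ 2 * a := by gcongr; nlinarith
  have hsa : 1 * a ≤ (s : ℝ) ^ 2 * a := by gcongr; nlinarith
  have e1 := apply_natCast_mul_eq_add_smul (pow_ne_zero 2 hl0) H ha (by linarith)
    (n := r ^ 2) (by positivity) (by push_cast; linarith)
  have e2 := apply_natCast_mul_eq_add_smul (pow_ne_zero 2 hl0) H ha (by linarith)
    (n := 2 * s ^ 2) (by positivity) (by push_cast; linarith)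
  have e3 := H (r ^ 2 * a) (r ^ 2 * a) (by positivity) (by positivity) (by linarith) (by linarith)
  push_cast at e1 e2
  rw [show l ^ 2 * ((r : ℝ) ^ 2 * a + r ^ 2 * a) = 2 * s ^ 2 * a by rw [← hl]; ring, e1, e2,
    ← hl] at e3
  refine smul_right_injective Y (sub_ne_zero.mpr hl2) ?_
  simp only
  linear_combination (norm := module) e3

/-- The pairs (r²a, r²a) and (r²a, 2r²a) give two relations. Their difference is l(l - 1)r² d = 0
for the common difference d, and with d = 0 the first reads h(a) = 2l h(a). -/
theorem apply_eq_zero_of_ratio_ne_one {r s : ℕ} (hr : 0 < r) (hs : 0 < s) {l : ℝ} (hl : l * r = s)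
    (hl1 : l ≠ 1) (hl2 : 2 * l ≠ 1)
    (H : ∀ a b, 0 < a → 0 < b → a < ρ → b < ρ → h (l ^ 2 * (a + b)) = l • (h a + h b))
    {a : ℝ} (ha : 0 < a) (hN : ((3 * s ^ 2 + 3 * r ^ 2 : ℕ) : ℝ) * a < ρ) :
    h a = 0 := by
  have hr1 : (1 : ℝ) ≤ r := by exact_mod_cast hr
  have hs1 : (1 : ℝ) ≤ s := by exact_mod_cast hs
  have hl0 : l ≠ 0 := by rintro rfl; rw [zero_mul] at hl; linarith
  push_cast at hN
  have hra : 1 * a ≤ (r : ℝ) ^ 2 * a := by gcongr; nlinarith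
  have hsa : 1 * a ≤ (s : ℝ) ^ 2 * a := by gcongr; nlinarith
  have e1 := apply_natCast_mul_eq_add_smul hl0 H ha (by linarith)
    (n := r ^ 2) (by positivity) (by push_cast; linarith)
  have e1' := apply_natCast_mul_eq_add_smul hl0 H ha (by linarith)
    (n := 2 * r ^ 2) (by positivity) (by push_cast; linarith)
  have e2 := apply_natCast_mul_eq_add_smul hl0 H ha (by linarith)
    (n := 2 * s ^ 2) (by positivity) (by push_cast; linarith)
  have e2' := apply_natCast_mul_eq_add_smul hl0 H ha (by linarith)
    (n := 3 * s ^ 2) (by positivity) (by push_cast; linarith)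
  have e3 := H (r ^ 2 * a) (r ^ 2 * a) (by positivity) (by positivity) (by linarith) (by linarith)
  have e3' := H (r ^ 2 * a) (2 * r ^ 2 * a) (by positivity) (by positivity) (by linarith)
    (by linarith)
  push_cast at e1 e2 e1' e2'
  rw [show l ^ 2 * ((r : ℝ) ^ 2 * a + r ^ 2 * a) = 2 * s ^ 2 * a by rw [← hl]; ring, e1, e2,
    ← hl] at e3
  rw [show l ^ 2 * ((r : ℝ) ^ 2 * a + 2 * r ^ 2 * a) = 3 * s ^ 2 * a by rw [← hl]; ring, e1, e1',
    e2', ← hl] at e3'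
  have hd : h (2 * a) - h a = 0 := by
    have hc : l * (l - 1) * (r : ℝ) ^ 2 ≠ 0 :=
      mul_ne_zero (mul_ne_zero hl0 (sub_ne_zero.mpr hl1)) (by positivity)
    refine smul_right_injective Y hc ?_
    simp only
    linear_combination (norm := module) e3' - e3
  rw [hd] at e3
  refine smul_right_injective Y (sub_ne_zero.mpr hl2) ?_
  simp only
  linear_combination (norm := module) -e3

/-- An odd map that is additive on small positive numbers is additive near zero. -/
theorem additive_near_zero_of_odd (hodd : ∀ a, h (-a) = -h a)
    (H : ∀ a b, 0 < a → 0 < b → a + b < ρ → h (a + b) = h a + h b)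
    {a b : ℝ} (ha : |a| < ρ) (hb : |b| < ρ) (hab : |a + b| < ρ) : h (a + b) = h a + h b := by
  have h0 : h 0 = 0 := by
    have h1 := hodd 0
    rw [neg_zero] at h1
    have : (2 : ℝ) • h 0 = 0 := by rw [two_smul]; nth_rewrite 1 [h1]; exact neg_add_cancel _
    exact (smul_eq_zero.mp this).resolve_left two_ne_zero
  have key : ∀ p q, 0 < p → 0 < q → p < ρ → q < ρ → h (p - q) = h p - h q := by
    intro p q hp hq hpρ hqρ
    rcases lt_trichotomy p q with hlt | rfl | hlt
    · have := H p (q - p) hp (by linarith) (by linarith)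
      rw [add_sub_cancel] at this
      rw [← neg_sub q p, hodd, this]; abel
    · simp [h0]
    · have := H q (p - q) hq (by linarith) (by linarith)
      rw [add_sub_cancel] at this
      rw [this]; abel
  rw [abs_lt] at ha hb hab
  rcases lt_trichotomy a 0 with h1 | rfl | h1 <;> rcases lt_trichotomy b 0 with h2 | rfl | h2
  · have := H (-a) (-b) (by linarith) (by linarith) (by linarith)
    rw [← neg_add, hodd, hodd, hodd] at this
    rw [← neg_neg (h (a + b)), this]; abel
  · simp [h0]
  · have := key b (-a) h2 (by linarith) (by linarith) (by linarith)
    rw [hodd] at this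
    rw [show a + b = b - -a by ring, this]; abel
  · simp [h0]
  · simp [h0]
  · simp [h0]
  · have := key a (-b) h1 (by linarith) (by linarith) (by linarith)
    rw [hodd] at this
    rw [show a + b = a - -b by ring, this]; abel
  · simp [h0]
  · exact H a b h1 h2 (by linarith)

end PositiveReals

/-! ### Odd and even solutions near zero -/

section Local

variable {X Y : Type*} [NormedAddCommGroup X] [InnerProductSpace ℝ X] [AddCommGroup Y] [Module ℝ Y]

/-- Equation `f (l (x + y)) = l (f x + f y)` for orthogonal nonzero `x, y` of norm less than `ρ`. -/
def OrthJensenNearZero (l ρ : ℝ) (f : X → Y) : Prop :=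
  ∀ x y : X, x ≠ 0 → y ≠ 0 → ‖x‖ < ρ → ‖y‖ < ρ → inner ℝ x y = 0 → f (l • (x + y)) = l • (f x + f y)

variable {l ρ : ℝ} {g : X → Y}

theorem OrthJensenNearZero.apply_on_ray (hX : 1 < Module.rank ℝ X) (hl : 0 < l)
    (hg : OrthJensenNearZero l ρ g) (hodd : ∀ x, g (-x) = -g x) {e : X} (he : ‖e‖ = 1) {a b : ℝ}
    (ha : 0 < a) (hb : 0 < b) (ha' : a < ρ / (2 * (1 + l))) (hb' : b < ρ / (2 * (1 + l))) :
    g ((l ^ 2 * (a + b)) • e) = l ^ 2 • (g (a • e) + g (b • e)) := by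
  have hc : 0 < 2 * (1 + l) := by positivity
  have hρ : 0 < ρ := by
    by_contra h
    have := div_nonpos_of_nonpos_of_nonneg (not_lt.mp h) hc.le
    linarith
  rw [lt_div_iff₀ hc] at ha' hb'
  have he0 : e ≠ 0 := norm_ne_zero_iff.mp (by rw [he]; exact one_ne_zero)
  -- The choice ‖y‖² = ab makes ae + y and be - y orthogonal; their sum is (a + b)e, and y cancels
  -- by oddness.
  obtain ⟨y, hy, hyn⟩ := exists_orthogonal_norm_eq hX e (Real.sqrt_nonneg (a * b))
  have hy2 : inner ℝ y y = a * b := by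
    rw [real_inner_self_eq_norm_sq, hyn, Real.sq_sqrt (by positivity)]
  have hee : inner ℝ e e = (1 : ℝ) := by rw [real_inner_self_eq_norm_sq, he, one_pow]
  have hyle : ‖y‖ ≤ max a b := by
    rw [hyn, Real.sqrt_le_left (le_max_of_le_left ha.le), sq]
    gcongr
    · exact le_max_left _ _
    · exact le_max_right _ _
  have hymax : ‖y‖ * (2 * (1 + l)) < ρ :=
    (mul_le_mul_of_nonneg_right hyle hc.le).trans_lt (by
      rcases max_choice a b with h | h <;> rw [h] <;> assumption)
  have hyρ : ‖y‖ < ρ := by nlinarith [norm_nonneg y, mul_nonneg (norm_nonneg y) hl.le]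
  have hy0 : y ≠ 0 := by
    rintro rfl
    rw [inner_zero_left] at hy2
    exact (mul_pos ha hb).ne hy2
  have hay : inner ℝ (a • e) y = 0 := by rw [inner_smul_left, hy, mul_zero]
  have hby : inner ℝ (b • e) (-y) = 0 := by
    rw [inner_neg_right, inner_smul_left, hy, mul_zero, neg_zero]
  have hna : ‖a • e‖ = a := by rw [norm_smul, he, mul_one, Real.norm_of_nonneg ha.le]
  have hnb : ‖b • e‖ = b := by rw [norm_smul, he, mul_one, Real.norm_of_nonneg hb.le]
  have hal := mul_pos ha hl
  have hbl := mul_pos hb hl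
  have h1 := hg (a • e) y (smul_ne_zero ha.ne' he0) hy0 (by rw [hna]; nlinarith) hyρ hay
  have h2 := hg (b • e) (-y) (smul_ne_zero hb.ne' he0) (neg_ne_zero.mpr hy0)
    (by rw [hnb]; nlinarith) (by rwa [norm_neg]) hby
  have hn1 : ‖l • (a • e + y)‖ < ρ := by
    rw [norm_smul, Real.norm_of_nonneg hl.le]
    have := norm_add_le (a • e) y
    rw [hna] at this
    nlinarith [mul_le_mul_of_nonneg_left this hl.le, norm_nonneg y]
  have hn2 : ‖l • (b • e + -y)‖ < ρ := by
    rw [norm_smul, Real.norm_of_nonneg hl.le]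
    have := norm_add_le (b • e) (-y)
    rw [hnb, norm_neg] at this
    nlinarith [mul_le_mul_of_nonneg_left this hl.le, norm_nonneg y]
  have horth : inner ℝ (l • (a • e + y)) (l • (b • e + -y)) = 0 := by
    simp only [inner_smul_left, inner_smul_right, inner_add_left, inner_add_right, inner_neg_right,
      hy, hy2, hee, real_inner_comm e y]
    simp only [conj_trivial]
    ring
  have h3 := hg _ _ (smul_ne_zero hl.ne' (add_ne_zero_of_inner_eq_zero hay (smul_ne_zero ha.ne' he0)))
    (smul_ne_zero hl.ne' (add_ne_zero_of_inner_eq_zero hby (smul_ne_zero hb.ne' he0))) hn1 hn2 horth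
  rw [h1, h2, hodd] at h3
  rw [show (l ^ 2 * (a + b)) • e = l • (l • (a • e + y) + l • (b • e + -y)) by module, h3]
  module

theorem OrthJensenNearZero.exists_addMonoidHom_of_odd (hX : 1 < Module.rank ℝ X)
    {r s : ℕ} (hr : 0 < r) (hs : 0 < s) (hlrs : l * r = s) (hl : 0 < l) (hl2 : 2 * l ^ 2 ≠ 1)
    (hρ : 0 < ρ) (hg : OrthJensenNearZero l ρ g) (hodd : ∀ x, g (-x) = -g x) :
    ∃ δ > 0, ∃ T : X →+ Y, ∀ x, ‖x‖ < δ → g x = T x := by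
  have hg0 : g 0 = 0 := by
    have h1 := hodd 0
    rw [neg_zero] at h1
    have : (2 : ℝ) • g 0 = 0 := by rw [two_smul]; nth_rewrite 1 [h1]; exact neg_add_cancel _
    exact (smul_eq_zero.mp this).resolve_left two_ne_zero
  set ρ' := ρ / (2 * (1 + l)) with hρ'
  have hρ'0 : 0 < ρ' := by positivity
  have hρ'ρ : ρ' ≤ ρ := div_le_self hρ.le (by linarith)
  set N : ℝ := ((3 * s ^ 2 + 3 * r ^ 2 : ℕ) : ℝ) with hN
  have hr1 : (1 : ℝ) ≤ r := by exact_mod_cast hr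
  have hs1 : (1 : ℝ) ≤ s := by exact_mod_cast hs
  have hrN : (r : ℝ) ≤ N := by rw [hN]; push_cast; nlinarith
  have hsN : (s : ℝ) ≤ N := by rw [hN]; push_cast; nlinarith
  have hN2 : 2 ≤ N := by rw [hN]; push_cast; nlinarith
  have hN0 : 0 < N := by linarith
  set δ := ρ' / N with hδ
  have hδ0 : 0 < δ := by positivity
  have hδρ' : δ ≤ ρ' := div_le_self hρ'0.le (by linarith)
  have hray (e : X) (he : ‖e‖ = 1) : ∀ a b, 0 < a → 0 < b → a < ρ' → b < ρ' →
      g ((l ^ 2 * (a + b)) • e) = l ^ 2 • (g (a • e) + g (b • e)) :=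
    fun a b ha hb ha' hb' => hg.apply_on_ray hX hl hodd he ha hb ha' hb'
  have hdouble (e : X) (he : ‖e‖ = 1) (a : ℝ) (ha : 0 < a) (ha' : a < δ) :
      g ((2 * a) • e) = (2 : ℝ) • g (a • e) := by
    rw [hδ, lt_div_iff₀' hN0] at ha'
    exact apply_two_mul_of_sq_ratio (h := fun a => g (a • e)) hr hs hlrs hl2 (hray e he) ha ha'
  have hpos (e : X) (he : ‖e‖ = 1) (a b : ℝ) (ha : 0 < a) (hb : 0 < b) (hab : a + b < δ) :
      g ((a + b) • e) = g (a • e) + g (b • e) := by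
    -- The pairs (a, b) and ((a+b)/2, (a+b)/2) have the same sum; doubling then turns the comparison
    -- into additivity.
    have h1 := hray e he a b ha hb (by linarith) (by linarith)
    have h2 := hray e he ((a + b) / 2) ((a + b) / 2) (by linarith) (by linarith) (by linarith)
      (by linarith)
    rw [add_halves, h1] at h2
    have h3 := smul_right_injective Y (pow_ne_zero 2 hl.ne') h2
    rw [h3, ← two_smul ℝ, ← hdouble e he _ (by linarith) (by linarith)]
    congr 2; ring
  have hline (e : X) (he : ‖e‖ = 1) (a b : ℝ) (ha : |a| < δ) (hb : |b| < δ) (hab : |a + b| < δ) :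
      g ((a + b) • e) = g (a • e) + g (b • e) :=
    additive_near_zero_of_odd (h := fun a => g (a • e)) (fun a => by rw [neg_smul, hodd])
      (hpos e he) ha hb hab
  have hmul (e : X) (he : ‖e‖ = 1) (a : ℝ) (ha : 0 < a) (ha' : a < δ) :
      g ((l * a) • e) = l • g (a • e) := by
    have hnat : ∀ n : ℕ, 0 < n → (n : ℝ) ≤ N → g ((n * (a / r)) • e) = (n : ℝ) • g ((a / r) • e) := by
      intro n hn hnN
      have har : a / r ≤ a := div_le_self ha.le hr1
      have har0 : 0 < a / r := by positivity
      have haN : N * a < ρ' := by rwa [hδ, lt_div_iff₀' hN0] at ha'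
      have h1 := apply_natCast_mul_eq_add_smul (h := fun a => g (a • e)) (pow_ne_zero 2 hl.ne')
        (hray e he) har0 (by nlinarith) hn (by nlinarith)
      rw [h1, hdouble e he _ har0 (by linarith)]
      module
    have h1 := hnat r hr hrN
    have h2 := hnat s hs hsN
    rw [mul_div_cancel₀ a (by positivity)] at h1
    rw [h1, smul_smul, hlrs, ← h2, ← hlrs]
    congr 2
    field_simp
  have horth (x y : X) (hxy : inner ℝ x y = 0) (hn : ‖x + y‖ < δ) : g (x + y) = g x + g y := by
    rcases eq_or_ne x 0 with rfl | hx
    · simp [hg0]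
    rcases eq_or_ne y 0 with rfl | hy
    · simp [hg0]
    have h1 := norm_le_norm_add_of_inner_eq_zero hxy
    have h2 := norm_le_norm_add_of_inner_eq_zero (x := y) (y := x) (by rwa [real_inner_comm])
    rw [add_comm y x] at h2
    -- g(l(x + y)) is computed twice: by the equation, and by l-homogeneity on the ray through x +
    -- y.
    have h3 := hg x y hx hy (by linarith) (by linarith) hxy
    have h0 := add_ne_zero_of_inner_eq_zero hxy hx
    have h4 := hmul (‖x + y‖⁻¹ • (x + y)) (norm_smul_inv_norm (𝕜 := ℝ) h0) ‖x + y‖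
      (norm_pos_iff.mpr h0) hn
    rw [mul_smul, smul_inv_smul₀ (norm_ne_zero_iff.mpr h0), h3] at h4
    exact (smul_right_injective Y hl.ne' h4).symm
  refine ⟨δ, hδ0, exists_addMonoidHom_eqOn {x | ‖x‖ < δ} g ?_ ?_ ?_⟩
  · intro x hx
    rw [Set.mem_ofPred_eq] at hx ⊢
    rw [NNReal.smul_def, norm_smul]
    norm_num
    linarith [norm_nonneg x]
  · intro x
    obtain ⟨n, hn⟩ := exists_pow_lt_of_lt_one (show 0 < δ / (‖x‖ + 1) by positivity)
      (show (2⁻¹ : ℝ) < 1 by norm_num)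
    refine ⟨n, ?_⟩
    rw [lt_div_iff₀ (by positivity)] at hn
    rw [Set.mem_ofPred_eq, NNReal.smul_def, norm_smul]
    push_cast
    rw [Real.norm_of_nonneg (by positivity)]
    have : (0 : ℝ) < 2⁻¹ ^ n := by positivity
    linarith
  · intro u hu v hv huv
    rw [Set.mem_ofPred_eq] at hu hv huv
    rcases eq_or_ne u 0 with rfl | hu0
    · simp [hg0]
    have hun : ‖u‖ ≠ 0 := norm_ne_zero_iff.mpr hu0
    obtain ⟨e, he⟩ : ∃ e, e = ‖u‖⁻¹ • u := ⟨_, rfl⟩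
    have he1 : ‖e‖ = 1 := by rw [he]; exact norm_smul_inv_norm (𝕜 := ℝ) hu0
    have hue : u = ‖u‖ • e := by rw [he, smul_inv_smul₀ hun]
    have hee : inner ℝ e e = (1 : ℝ) := by rw [real_inner_self_eq_norm_sq, he1, one_pow]
    -- Splitting v along e and its orthogonal complement reduces additivity to the line ℝe and to
    -- orthogonal pairs.
    obtain ⟨β, hβ⟩ : ∃ β : ℝ, β = inner ℝ e v := ⟨_, rfl⟩
    obtain ⟨w, hw⟩ : ∃ w, w = v - β • e := ⟨_, rfl⟩
    have hew (c : ℝ) : inner ℝ (c • e) w = 0 := by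
      rw [hw, inner_smul_left, inner_sub_right, inner_smul_right, hee, ← hβ]; simp
    have hv' : v = β • e + w := by rw [hw]; abel
    have huv' : u + v = (‖u‖ + β) • e + w := by rw [add_smul, ← hue, add_assoc, ← hv']
    have habs (c : ℝ) : ‖c • e‖ = |c| := by rw [norm_smul, he1, mul_one, Real.norm_eq_abs]
    have h1 := norm_le_norm_add_of_inner_eq_zero (hew β)
    rw [← hv', habs] at h1
    have h2 := norm_le_norm_add_of_inner_eq_zero (hew (‖u‖ + β))
    rw [← huv', habs] at h2
    have h3 := horth _ _ (hew (‖u‖ + β)) (by rwa [← huv'])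
    have h4 := horth _ _ (hew β) (by rwa [← hv'])
    rw [← huv', hline e he1 ‖u‖ β (by rwa [abs_norm]) (by linarith) (by linarith), ← hue] at h3
    rw [← hv'] at h4
    rw [h3, h4, add_assoc]

/-- Equal norms make u + v ⟂ u - v, so u = l(p + q) and v = l(p - q) with p ⟂ q; evenness hides the
sign of q. -/
theorem OrthJensenNearZero.apply_eq_of_norm_eq_of_even (hl : 0 < l)
    (hg : OrthJensenNearZero l ρ g) (heven : ∀ x, g (-x) = g x) {u v : X} (huv : ‖u‖ = ‖v‖)
    (hu : ‖u‖ < l * ρ) : g u = g v := by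
  have hl0 := hl.ne'
  obtain ⟨p, hp⟩ : ∃ p, p = (2 * l)⁻¹ • (u + v) := ⟨_, rfl⟩
  obtain ⟨q, hq⟩ : ∃ q, q = (2 * l)⁻¹ • (u - v) := ⟨_, rfl⟩
  have hu' : u = l • (p + q) := by rw [hp, hq]; match_scalars <;> field_simp <;> norm_num
  have hv' : v = l • (p + -q) := by rw [hp, hq]; match_scalars <;> field_simp <;> norm_num
  have hpq : inner ℝ p q = 0 := by
    rw [hp, hq, inner_smul_left, inner_smul_right, (real_inner_add_sub_eq_zero_iff u v).mpr huv]
    simp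
  have hbound : ∀ w : X, ‖w‖ ≤ ‖u‖ + ‖v‖ → ‖(2 * l)⁻¹ • w‖ < ρ := by
    intro w hw
    rw [norm_smul, Real.norm_of_nonneg (by positivity), inv_mul_lt_iff₀ (by positivity)]
    linarith
  have hpn : ‖p‖ < ρ := by rw [hp]; exact hbound _ (norm_add_le u v)
  have hqn : ‖q‖ < ρ := by rw [hq]; exact hbound _ (norm_sub_le u v)
  rcases eq_or_ne p 0 with hp0 | hp0
  · rw [hu', hv', hp0, zero_add, zero_add, smul_neg, heven]
  rcases eq_or_ne q 0 with hq0 | hq0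
  · rw [hu', hv', hq0, neg_zero]
  rw [hu', hv', hg p q hp0 hq0 hpn hqn hpq, hg p (-q) hp0 (neg_ne_zero.mpr hq0) hpn
    (by rwa [norm_neg]) (by rw [inner_neg_right, hpq, neg_zero]), heven]

theorem OrthJensenNearZero.exists_addMonoidHom_of_even (hX : 1 < Module.rank ℝ X)
    {r s : ℕ} (hr : 0 < r) (hs : 0 < s) (hlrs : l * r = s) (hl : 0 < l) (hl2 : 2 * l ≠ 1)
    (hρ : 0 < ρ) (hg : OrthJensenNearZero l ρ g) (heven : ∀ x, g (-x) = g x) :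
    ∃ δ > 0, ∃ b : NNReal →+ Y, (l ≠ 1 → b = 0) ∧
      ∀ x, x ≠ 0 → ‖x‖ < δ → g x = b (‖x‖₊ ^ 2) := by
  obtain ⟨e, -, he⟩ := exists_orthogonal_norm_eq hX 0 zero_le_one
  obtain ⟨e', hee', he'⟩ := exists_orthogonal_norm_eq hX e zero_le_one
  have hne : e ≠ 0 := norm_ne_zero_iff.mp (by rw [he]; exact one_ne_zero)
  have hne' : e' ≠ 0 := norm_ne_zero_iff.mp (by rw [he']; exact one_ne_zero)
  obtain ⟨h, hh⟩ : ∃ h : ℝ → Y, h = fun a => g (√a • e) := ⟨_, rfl⟩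
  have hn (a : ℝ) {w : X} (hw : ‖w‖ = 1) : ‖√a • w‖ = √a := by
    rw [norm_smul, hw, mul_one, Real.norm_of_nonneg (Real.sqrt_nonneg a)]
  have hgh : ∀ x, ‖x‖ < l * ρ → g x = h (‖x‖ ^ 2) := by
    intro x hx
    rw [hh]
    exact hg.apply_eq_of_norm_eq_of_even hl heven
      (by rw [hn _ he, Real.sqrt_sq (norm_nonneg x)]) hx
  obtain ⟨ρ', hρ'0, hρ', hρ''⟩ : ∃ ρ' : ℝ, 0 < ρ' ∧ ρ' ≤ ρ ^ 2 / 2 ∧ ρ' ≤ (l * ρ) ^ 2 :=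
    ⟨min (ρ ^ 2 / 2) ((l * ρ) ^ 2), by positivity, min_le_left _ _, min_le_right _ _⟩
  have H : ∀ a b, 0 < a → 0 < b → a < ρ' → b < ρ' →
      h (l ^ 2 * (a + b)) = l • (h a + h b) := by
    intro a b ha hb ha' hb'
    have hsq : ∀ c, c < ρ ^ 2 → √c < ρ := fun c hc => (Real.sqrt_lt' hρ).mpr hc
    have horth : inner ℝ (√a • e) (√b • e') = 0 := by
      rw [inner_smul_left, inner_smul_right, hee', mul_zero, mul_zero]
    have hnorm : ‖√a • e + √b • e'‖ ^ 2 = a + b := by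
      rw [norm_sq_add_of_inner_eq_zero horth, hn a he, hn b he', Real.sq_sqrt ha.le,
        Real.sq_sqrt hb.le]
    have hnorm' : ‖√a • e + √b • e'‖ < ρ := by
      rw [← Real.sqrt_sq (norm_nonneg _), hnorm]; exact hsq _ (by linarith)
    have hg1 := hgh (l • (√a • e + √b • e')) (by
      rw [norm_smul, Real.norm_of_nonneg hl.le]; exact mul_lt_mul_of_pos_left hnorm' hl)
    have hg2 : g (√b • e') = g (√b • e) :=
      hg.apply_eq_of_norm_eq_of_even hl heven (by rw [hn b he, hn b he'])
        (by rw [hn b he']; exact (Real.sqrt_lt' (by positivity)).mpr (by linarith))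
    rw [norm_smul, mul_pow, hnorm, Real.norm_of_nonneg hl.le] at hg1
    rw [← hg1, hg _ _ (smul_ne_zero (Real.sqrt_pos.mpr ha).ne' hne)
      (smul_ne_zero (Real.sqrt_pos.mpr hb).ne' hne') (by rw [hn a he]; exact hsq a (by linarith))
      (by rw [hn b he']; exact hsq b (by linarith)) horth, hg2, hh]
  by_cases hl1 : l = 1
  · subst hl1
    obtain ⟨b, hb⟩ := exists_addMonoidHom_eqOn {a : NNReal | (a : ℝ) < ρ'}
      -- The equation says nothing about g at 0, so the value there is reset to 0 for additivity.
      (fun a => if a = 0 then 0 else h a) (by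
        intro a ha
        rw [Set.mem_ofPred_eq] at ha ⊢
        rw [smul_eq_mul]
        push_cast
        linarith [a.2]) (by
        intro a
        obtain ⟨n, hn⟩ := exists_pow_lt_of_lt_one (show 0 < ρ' / (a + 1) by positivity)
          (show (2⁻¹ : ℝ) < 1 by norm_num)
        refine ⟨n, ?_⟩
        rw [lt_div_iff₀ (by positivity)] at hn
        rw [Set.mem_ofPred_eq, smul_eq_mul]
        push_cast
        have : (0 : ℝ) < 2⁻¹ ^ n := by positivity
        linarith) (by
        intro u hu v hv huv
        rcases eq_or_ne u 0 with rfl | hu0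
        · simp
        rcases eq_or_ne v 0 with rfl | hv0
        · simp
        have huv0 : u + v ≠ 0 := by simp [hu0]
        have := H u v (NNReal.coe_pos.mpr (pos_iff_ne_zero.mpr hu0))
          (NNReal.coe_pos.mpr (pos_iff_ne_zero.mpr hv0)) hu hv
        rw [one_pow, one_mul, one_smul] at this
        simp only [hu0, hv0, huv0, if_false]
        rw [NNReal.coe_add, this])
    refine ⟨min (1 * ρ) (√ρ'), by positivity, b, fun h => absurd rfl h, fun x hx hxδ => ?_⟩
    rw [lt_min_iff] at hxδ
    have hx2 : ‖x‖₊ ^ 2 ≠ 0 := pow_ne_zero 2 (nnnorm_ne_zero_iff.mpr hx)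
    rw [← hb, if_neg hx2, hgh x hxδ.1]
    · simp
    · rw [Set.mem_ofPred_eq]
      push_cast
      exact (Real.lt_sqrt (norm_nonneg x)).mp hxδ.2
  · set N : ℝ := ((3 * s ^ 2 + 3 * r ^ 2 : ℕ) : ℝ)
    have hN0 : 0 < N := Nat.cast_pos.mpr (by positivity)
    refine ⟨min (l * ρ) (√(ρ' / N)), by positivity, 0, fun _ => rfl, fun x hx hxδ => ?_⟩
    rw [lt_min_iff] at hxδ
    have hx2 : 0 < ‖x‖ ^ 2 := pow_pos (norm_pos_iff.mpr hx) 2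
    rw [hgh x hxδ.1]
    exact apply_eq_zero_of_ratio_ne_one hr hs hlrs hl1 hl2 H hx2
      ((lt_div_iff₀' hN0).mp ((Real.lt_sqrt (norm_nonneg x)).mp hxδ.2))

end Local

/-! ### From a neighbourhood of zero to the whole ball -/

section Global

variable {X Y : Type*} [NormedAddCommGroup X] [InnerProductSpace ℝ X] [AddCommGroup Y] [Module ℝ Y]
  {l R : ℝ} {f : X → Y}

/-- The smaller radius makes the condition on ‖l(x + y)‖ automatic. -/
theorem OrthJensenBelow.orthJensenNearZero (hl : 0 < l) (hf : OrthJensenBelow l R f) :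
    OrthJensenNearZero l (R / (2 * (1 + l))) f := by
  intro x y hx hy hxn hyn hxy
  rw [lt_div_iff₀ (by positivity)] at hxn hyn
  have h1 := mul_nonneg (norm_nonneg x) hl.le
  have h2 := mul_nonneg (norm_nonneg y) hl.le
  have h3 := norm_nonneg x
  have h4 := norm_nonneg y
  refine hf x y hx hy (by nlinarith) (by nlinarith) hxy ?_
  rw [norm_smul, Real.norm_of_nonneg hl.le]
  nlinarith [mul_le_mul_of_nonneg_left (norm_add_le x y) hl.le]

theorem OrthJensenBelow.smul_add_smul_comp_neg (hf : OrthJensenBelow l R f) (c d : ℝ) :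
    OrthJensenBelow l R (fun x => c • f x + d • f (-x)) := by
  intro x y hx hy hxn hyn hxy hn
  have h1 := hf x y hx hy hxn hyn hxy hn
  have h2 := hf (-x) (-y) (neg_ne_zero.mpr hx) (neg_ne_zero.mpr hy) (by rwa [norm_neg])
    (by rwa [norm_neg]) (by rwa [inner_neg_neg]) (by rwa [← neg_add, smul_neg, norm_neg])
  rw [← neg_add, smul_neg] at h2
  simp only [h1, h2]
  module

/-- For `l > 1 / √2`, a solution that vanishes near zero vanishes on the whole punctured ball. -/
theorem OrthJensenBelow.eq_zero_of_eq_zero_near_zero (hX : 1 < Module.rank ℝ X) (hl : 0 < l)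
    (hl2 : 1 < 2 * l ^ 2) (hf : OrthJensenBelow l R f) {δ : ℝ} (hδ : 0 < δ)
    (h0 : ∀ x, x ≠ 0 → ‖x‖ < δ → f x = 0) {x : X} (hx : x ≠ 0) (hxR : ‖x‖ < R) : f x = 0 := by
  have key : ∀ n : ℕ, ∀ z : X, z ≠ 0 → ‖z‖ < R → ‖z‖ ^ 2 < (2 * l ^ 2) ^ n * δ ^ 2 → f z = 0 := by
    intro n
    induction n with
    | zero =>
      intro z hz _ hzδ
      rw [pow_zero, one_mul] at hzδ
      exact h0 z hz (lt_of_pow_lt_pow_left₀ 2 hδ.le hzδ)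
    | succ n ih =>
      intro z hz hzR hzδ
      -- With ‖y‖ = ‖z‖ and y ⟂ z, the vectors (z ± y)/(2l) are orthogonal, have squared norm
      -- ‖z‖²/(2l²), and l times their sum is z.
      obtain ⟨y, hzy, hyn⟩ := exists_orthogonal_norm_eq hX z (norm_nonneg z)
      have hzy' : inner ℝ z (-y) = 0 := by rw [inner_neg_right, hzy, neg_zero]
      have hc : (2 * l)⁻¹ ≠ 0 := by positivity
      have hnorm : ∀ w : X, ‖w‖ = ‖z‖ → inner ℝ z w = 0 →
          ‖(2 * l)⁻¹ • (z + w)‖ ^ 2 * (2 * l ^ 2) = ‖z‖ ^ 2 := by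
        intro w hw hzw
        rw [norm_smul, mul_pow, norm_sq_add_of_inner_eq_zero hzw, hw,
          Real.norm_of_nonneg (by positivity)]
        field_simp
        ring
      have hlt : ∀ w : X, ‖w‖ = ‖z‖ → inner ℝ z w = 0 →
          ‖(2 * l)⁻¹ • (z + w)‖ < R ∧ f ((2 * l)⁻¹ • (z + w)) = 0 := by
        intro w hw hzw
        have h1 := hnorm w hw hzw
        have hR : ‖(2 * l)⁻¹ • (z + w)‖ < R := by
          refine lt_of_le_of_lt ?_ hzR
          refine (sq_le_sq₀ (norm_nonneg _) (norm_nonneg _)).mp ?_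
          nlinarith [sq_nonneg ‖(2 * l)⁻¹ • (z + w)‖]
        refine ⟨hR, ih _ (smul_ne_zero hc (add_ne_zero_of_inner_eq_zero hzw hz)) hR ?_⟩
        rw [← h1, pow_succ (2 * l ^ 2)] at hzδ
        refine lt_of_mul_lt_mul_right (a := 2 * l ^ 2) ?_ (by positivity)
        linarith
      obtain ⟨h1, h2⟩ := hlt y hyn hzy
      obtain ⟨h3, h4⟩ := hlt (-y) (by rw [norm_neg, hyn]) hzy'
      have hz' : l • ((2 * l)⁻¹ • (z + y) + (2 * l)⁻¹ • (z + -y)) = z := by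
        have := hl.ne'
        match_scalars <;> field_simp <;> norm_num
      have h5 := hf _ _ (smul_ne_zero hc (add_ne_zero_of_inner_eq_zero hzy hz))
        (smul_ne_zero hc (add_ne_zero_of_inner_eq_zero hzy' hz)) h1 h3 (by
          rw [inner_smul_left, inner_smul_right, ← sub_eq_add_neg,
            (real_inner_add_sub_eq_zero_iff z y).mpr hyn.symm]
          simp) (by rwa [hz'])
      rwa [hz', h2, h4, add_zero, smul_zero] at h5
  obtain ⟨n, hn⟩ := pow_unbounded_of_one_lt (‖x‖ ^ 2 / δ ^ 2) hl2
  exact key n x hx hxR ((div_lt_iff₀ (by positivity)).mp hn)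

theorem AddMonoidHom.map_smul_of_mul_natCast_eq_natCast (T : X →+ Y) {r s : ℕ} (hr : 0 < r)
    (hl : l * r = s) (x : X) : T (l • x) = l • T x := by
  have hr0 : (r : ℝ) ≠ 0 := by positivity
  refine smul_right_injective Y hr0 ?_
  simp only
  rw [smul_smul, mul_comm, hl, Nat.cast_smul_eq_nsmul, Nat.cast_smul_eq_nsmul, ← map_nsmul,
    ← map_nsmul, ← Nat.cast_smul_eq_nsmul ℝ, ← Nat.cast_smul_eq_nsmul ℝ, smul_smul, mul_comm, hl]

theorem OrthJensenBelow.exists_addMonoidHom (hX : 1 < Module.rank ℝ X) {r s : ℕ} (hr : 0 < r)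
    (hs : 0 < s) (hlrs : l * r = s) (hl : 0 < l) (hl2 : 1 < 2 * l ^ 2) (hR : 0 < R)
    (hf : OrthJensenBelow l R f) :
    ∃ (T : X →+ Y) (b : NNReal →+ Y), ∀ x, x ≠ 0 → ‖x‖ < R → f x = T x + b (‖x‖₊ ^ 2) := by
  have hρ : 0 < R / (2 * (1 + l)) := by positivity
  obtain ⟨δ, hδ, T, hT⟩ :=
    ((hf.smul_add_smul_comp_neg (1 / 2) (-(1 / 2))).orthJensenNearZero hl).exists_addMonoidHom_of_odd
      hX hr hs hlrs hl hl2.ne' hρ (fun x => by rw [neg_neg]; module)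
  obtain ⟨δ', hδ', b, hb0, hb⟩ :=
    ((hf.smul_add_smul_comp_neg (1 / 2) (1 / 2)).orthJensenNearZero hl).exists_addMonoidHom_of_even
      hX hr hs hlrs hl (by rintro h; nlinarith) hρ (fun x => by rw [neg_neg]; module)
  refine ⟨T, b, fun x hx hxR => ?_⟩
  have hdiff : OrthJensenBelow l R (fun x => f x - (T x + b (‖x‖₊ ^ 2))) := by
    intro x y hx hy hxn hyn hxy hn
    -- The radial term solves the equation by Pythagoras if l = 1, and because b = 0 otherwise.
    have hbl : b (‖l • (x + y)‖₊ ^ 2) = l • (b (‖x‖₊ ^ 2) + b (‖y‖₊ ^ 2)) := by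
      by_cases hl1 : l = 1
      · rw [hl1, one_smul, one_smul, ← map_add]
        congr 1
        apply NNReal.coe_injective
        push_cast
        exact norm_sq_add_of_inner_eq_zero hxy
      · simp [hb0 hl1]
    simp only
    rw [hf x y hx hy hxn hyn hxy hn, hbl, T.map_smul_of_mul_natCast_eq_natCast hr hlrs, map_add]
    module
  refine sub_eq_zero.mp (hdiff.eq_zero_of_eq_zero_near_zero hX hl hl2 (lt_min hδ hδ') ?_ hx hxR)
  intro x hx hxδ
  rw [lt_min_iff] at hxδ
  rw [← hT x hxδ.1, ← hb x hx hxδ.2]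
  module

end Global

theorem theorem6p2 {X Y : Type*} [NormedAddCommGroup X] [InnerProductSpace ℝ X]
    (hX : 1 < Module.rank ℝ X)
    [AddCommGroup Y] [Module ℝ Y] [UniformSpace Y] [IsUniformAddGroup Y] [ContinuousSMul ℝ Y]
    (hY : IsSequentiallyComplete Y)
    (r s t : ℕ) (hr : 0 < r) (hs : 0 < s) (ht : 0 < t)
    (hst : s = t) (hsr : 1 / Real.sqrt 2 * (r : ℝ) < (s : ℝ))
    (R : ℝ) (hR : 0 < R) (f : X → Y)
    (hf : IsOrthogonallyGeneralizedJensenOn r s t (Metric.ball (0 : X) R \ {0}) f) :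
    ∃ (T : X →+ Y) (b : NNReal →+ Y),
      ∀ x ∈ Metric.ball (0 : X) R \ {0}, f x = T x + b (‖x‖₊ ^ 2) := by
  subst hst
  have hr0 : (0 : ℝ) < r := Nat.cast_pos.mpr hr
  have hs0 : (0 : ℝ) < s := Nat.cast_pos.mpr hs
  have hl : 0 < (s : ℝ) / r := by positivity
  have hl2 : 1 < 2 * ((s : ℝ) / r) ^ 2 := by
    have h1 : (1 / √2 * (r : ℝ)) ^ 2 < (s : ℝ) ^ 2 := by gcongr
    rw [mul_pow, div_pow, Real.sq_sqrt zero_le_two] at h1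
    rw [div_pow, ← mul_div_assoc, one_lt_div (by positivity)]
    linarith
  have hJ : OrthJensenBelow ((s : ℝ) / r) R f := by
    intro x y hx hy hxn hyn hxy hn
    have e : (r : ℝ)⁻¹ • ((s : ℝ) • x + (s : ℝ) • y) = ((s : ℝ) / r) • (x + y) := by
      rw [← smul_add, smul_smul, inv_mul_eq_div]
    have h1 := hf x ⟨by simpa using hxn, hx⟩ y ⟨by simpa using hyn, hy⟩ hxy (by
      rw [e]
      exact ⟨by rwa [mem_ball_zero_iff],
        smul_ne_zero hl.ne' (add_ne_zero_of_inner_eq_zero hxy hx)⟩)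
    rw [e] at h1
    refine smul_right_injective Y hr0.ne' ?_
    simp only
    rw [h1, smul_smul, mul_div_cancel₀ _ hr0.ne', smul_add]
  obtain ⟨T, b, h⟩ := hJ.exists_addMonoidHom hX hr hs (div_mul_cancel₀ _ hr0.ne') hl hl2 hR
  exact ⟨T, b, fun x hx => h x hx.2 (by simpa using hx.1)⟩
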